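/- Let $\alpha>0$ be a real number. Identify a partition $\lambda$ with its Ferrers diagram $\{(i,j): 1\le i\le l(\lambda),\ 1\le j\le\lambda_i\}$, write $|\lambda|$ for its weight, $m_i(\lambda)$ for the multiplicity of $i$ as a part of $\lambda$, and put $z_\lambda=\prod_{i\ge1} i^{m_i(\lambda)}\,m_i(\lambda)!$. For an integer $r\ge 0$ let $\left\langle{\lambda\atop r}\right\rangle$ be the number of ways to choose $r$ cells in the diagram of $\lambda$ so that at least one cell is chosen in each row. For integers $j,k\ge0$ define the polynomial $$P_{jk}(X_1,X_2,\dots)=\sum_{|\mu|=j}\frac{\left\langle{\mu\atop k}\right\rangle}{z_\mu}\prod_{i\ge1}X_i^{m_i(\mu)},$$ the sum being over all partitions $\mu$ of $j$ (so $P_{00}=1$). For a partition $\lambda$ put $$d_k(\lambda)=\sum_{(i,j)\in\lambda}\Bigl(j-1-\frac{i-1}{\alpha}\Bigr)^k,\qquad (z)_\lambda=\prod_{(i,j)\in\lambda}\Bigl(z+j-1-\frac{i-1}{\alpha}\Bigr),\qquad F_{jk}(\lambda)=P_{jk}(d_1(\lambda),d_2(\lambda),\dots).$$ **Theorem.** Let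 $x,y$ be independent indeterminates. For every partition $\lambda$, $$\frac{(y-x)_\lambda}{(y)_\lambda}=\sum_{i,j\ge0}(-1)^{i+j}\frac{x^i}{y^{i+j}}\left(\sum_{k=0}^{\min(i,j)}\binom{|\lambda|-j}{i-k}F_{jk}(\lambda)\right).$$ This is an identity of formal series: the rational function on the left is expanded in powers of $1/y$, and the double series on the right converges (unconditionally) to it in the field $\mathbb R(x)((1/y))$ of formal Laurent series in $1/y$, with its $(1/y)$-adic topology. Here $\binom{z}{n}=z(z-1)\cdots(z-n+1)/n!$, also when $z$ is a negative integer. -/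

import Mathlib

namespace JackExpansion

/-- The Ferrers diagram of a partition `μ` of `n`, with rows and columns numbered from `0`:
the row `i` has as many cells as the `i`-th largest part of `μ`. -/
def diagram {n : ℕ} (μ : n.Partition) : YoungDiagram :=
  YoungDiagram.ofRowLens (μ.parts.sort (· ≥ ·)) (Multiset.pairwise_sort μ.parts (· ≥ ·)).sortedGE

/-- The multiplicity `m_i(μ)` of `i` as a part of `μ`. -/
def mult {n : ℕ} (μ : n.Partition) (i : ℕ) : ℕ := μ.parts.count i

/-- `z_μ = ∏_{i ≥ 1} i ^ m_i(μ) * m_i(μ)!`. -/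
def zee {n : ℕ} (μ : n.Partition) : ℕ :=
  ∏ i ∈ Finset.Icc 1 n, i ^ mult μ i * (mult μ i).factorial

/-- The generalized binomial coefficient `⟨μ, r⟩`: the number of ways to choose `r` cells in the
diagram of `μ` with at least one cell chosen in each row. -/
def genBinom {n : ℕ} (μ : n.Partition) (r : ℕ) : ℕ :=
  (((diagram μ).cells.powersetCard r).filter
    fun S => ∀ c ∈ (diagram μ).cells, ∃ s ∈ S, s.1 = c.1).card

/-- The polynomial `P_{jk}(X) = ∑_{|μ| = j} ⟨μ, k⟩ / z_μ * ∏_{i ≥ 1} X_i ^ m_i(μ)` in the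
indeterminates `X_1, X_2, …` (the variable of index `0` does not occur in it). -/
noncomputable def P (j k : ℕ) : MvPolynomial ℕ ℚ :=
  ∑ μ : j.Partition, MvPolynomial.C ((genBinom μ k : ℚ) / (zee μ : ℚ)) *
    ∏ i ∈ Finset.Icc 1 j, MvPolynomial.X i ^ mult μ i

/-- The content `j - 1 - (i - 1) / α` of the cell in row `i` and column `j`, these being numbered
from `1`; in the numbering from `0` of a cell `c` of a diagram it is `c.2 - c.1 / α`. -/
noncomputable def content (α : ℝ) (c : ℕ × ℕ) : ℝ := (c.2 : ℝ) - (c.1 : ℝ) / α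

/-- The power sum `d_k(μ)` of the contents of the cells of `μ`. -/
noncomputable def d (α : ℝ) {n : ℕ} (μ : n.Partition) (k : ℕ) : ℝ :=
  ∑ c ∈ (diagram μ).cells, content α c ^ k

/-- `F_{jk}(μ) = P_{jk}(d_1(μ), d_2(μ), …)`. -/
noncomputable def F (α : ℝ) (j k : ℕ) {n : ℕ} (μ : n.Partition) : ℝ :=
  MvPolynomial.aeval (fun i : ℕ => d α μ i) (P j k)

/-- The field `ℝ(x)((1/y))` of formal Laurent series in `1/y` over the field of rational functions
in `x`, with its `(1/y)`-adic topology. It contains the field `ℝ(x, y)`. -/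
abbrev FormalField : Type := LaurentSeries (RatFunc ℝ)

/-- The indeterminate `x`. -/
noncomputable def x : FormalField := HahnSeries.C RatFunc.X

/-- The indeterminate `y`, the inverse of the variable of the Laurent series. -/
noncomputable def y : FormalField := HahnSeries.single (-1 : ℤ) 1

/-- The inclusion of the real numbers, as constants, into `ℝ(x)((1/y))`. -/
noncomputable def const : ℝ →+* FormalField := HahnSeries.C.comp RatFunc.C

/-- The generalized rising factorial `(z)_μ`, the product over the cells of `μ` of `z` plus the
content of the cell. -/
noncomputable def risingFactorial (α : ℝ) {n : ℕ} (μ : n.Partition) (z : FormalField) :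
    FormalField :=
  ∏ c ∈ (diagram μ).cells, (z + const (content α c))

end JackExpansion

/-!
Write `n` for the number of cells and `c_a` for their contents. Choices of cells of the diagram of
`μ` that meet every row are counted by `∏ ((1 + q) ^ i - 1) ^ m_i(μ)`, where `q` marks a chosen
cell. Hence `∑ k, F_{jk} q ^ k` is the cycle index `∑_{|μ| = j} ∏ p_i ^ m_i(μ) / z_μ` at
`p_i = ((1 + q) ^ i - 1) d_i`. For `1 + q = w`, dividing it by `w ^ j` replaces `p_i` by
`∑ a, (c_a ^ i - (c_a / w) ^ i)`, so the recursion `j h_j = ∑ i, p_i h_{j-i}` of the cycle indices,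
which is a logarithmic derivative, gives
`∑ j, w ^ (n - j) (∑ k, F_{jk} (w - 1) ^ k) T ^ j = ∏ a, (w - c_a T) / (1 - c_a T)`.
At `w = 1 - x / y` and `T = -1 / y` the right side is `∏ a, (y - x + c_a) / (y + c_a)`, and the
binomial coefficients are those of the powers `w ^ (n - j)`.
-/

namespace JackExpansion

open Finset PowerSeries

section Partition

@[to_additive]
lemma prod_map_parts {M : Type*} [CommMonoid M] {n : ℕ} (μ : n.Partition) (f : ℕ → M) :
    (μ.parts.map f).prod = ∏ i ∈ Icc 1 n, f i ^ mult μ i := by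
  rw [prod_multiset_map_count]
  refine prod_subset (fun i hi => ?_) fun i _ hi => ?_
  · rw [Multiset.mem_toFinset] at hi
    exact mem_Icc.2 ⟨μ.parts_pos hi, Nat.Partition.le_of_mem_parts hi⟩
  · rw [Multiset.count_eq_zero.2 (by simpa using hi), pow_zero]

lemma sum_mult_mul {n : ℕ} (μ : n.Partition) : ∑ i ∈ Icc 1 n, mult μ i * i = n := by
  simpa [μ.parts_sum] using (sum_map_parts μ id).symm

lemma mult_eq_zero_of_lt {n : ℕ} (μ : n.Partition) {i : ℕ} (h : n < i) : mult μ i = 0 :=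
  Multiset.count_eq_zero.2 fun hi => (Nat.Partition.le_of_mem_parts hi).not_gt h

end Partition

section Diagram

variable {R : Type*} [CommRing R]

@[to_additive]
lemma prod_map_rowLens {M : Type*} [CommMonoid M] (Y : YoungDiagram) (f : ℕ → M) :
    (Y.rowLens.map f).prod = ∏ i ∈ range (Y.colLen 0), f (Y.rowLen i) := by
  rw [YoungDiagram.rowLens, List.map_map]
  rfl

lemma image_fst_cells (Y : YoungDiagram) : Y.cells.image Prod.fst = range (Y.colLen 0) := by
  ext i
  simp only [mem_image, YoungDiagram.mem_cells, Prod.exists, exists_and_right, exists_eq_right,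
    mem_range, ← YoungDiagram.mem_iff_lt_colLen]
  exact ⟨fun ⟨j, hj⟩ => Y.up_left_mem le_rfl (Nat.zero_le j) hj, fun h => ⟨0, h⟩⟩

lemma sum_rowLens (Y : YoungDiagram) : Y.rowLens.sum = #Y.cells := by
  rw [← List.map_id Y.rowLens, sum_map_rowLens, ← image_fst_cells, card_eq_sum_card_image Prod.fst]
  exact sum_congr rfl fun i _ => Y.rowLen_eq_card

lemma rowLens_diagram {n : ℕ} (μ : n.Partition) :
    (diagram μ).rowLens = μ.parts.sort (· ≥ ·) :=
  YoungDiagram.rowLens_ofRowLens_eq_self fun _ ha => μ.parts_pos (by simpa using ha)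

lemma prod_map_rowLens_diagram {M : Type*} [CommMonoid M] {n : ℕ} (μ : n.Partition) (f : ℕ → M) :
    ((diagram μ).rowLens.map f).prod = (μ.parts.map f).prod := by
  rw [rowLens_diagram, ← Multiset.prod_coe, ← Multiset.map_coe, Multiset.sort_eq]

lemma card_cells_diagram {n : ℕ} (μ : n.Partition) : #(diagram μ).cells = n := by
  rw [← sum_rowLens, rowLens_diagram, ← Multiset.sum_coe, Multiset.sort_eq, μ.parts_sum]

lemma sum_pow_card_powerset_erase_empty {ι : Type*} [DecidableEq ι] (q : R) (s : Finset ι) :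
    ∑ t ∈ s.powerset.erase ∅, q ^ #t = (1 + q) ^ #s - 1 := by
  rw [sum_erase_eq_sub (empty_mem_powerset s), add_comm, ← sum_pow_mul_eq_add_pow]
  simp

lemma sum_pow_card_filter_meets_fibers {ι κ : Type*} [DecidableEq κ] (q : R)
    (s : Finset ι) (f : ι → κ) :
    ∑ t ∈ s.powerset with ∀ a ∈ s, ∃ b ∈ t, f b = f a, q ^ #t =
      ∏ i ∈ s.image f, ((1 + q) ^ #{a ∈ s | f a = i} - 1) := by
  classical
  simp only [← sum_pow_card_powerset_erase_empty, prod_sum]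
  refine sum_bij' (fun t _ i _ => {a ∈ t | f a = i})
    (fun p _ => {a ∈ s | ∃ h : f a ∈ s.image f, a ∈ p (f a) h}) ?_ ?_ ?_ ?_ ?_
  · simp only [mem_filter, mem_powerset, mem_pi, mem_erase, ← nonempty_iff_ne_empty,
      filter_nonempty_iff, forall_mem_image]
    exact fun t ht a ha => ⟨ht.2 a ha, filter_subset_filter _ ht.1⟩
  · simp only [mem_filter, mem_powerset, mem_pi, mem_erase, ← nonempty_iff_ne_empty,
      filter_subset, true_and]
    intro p hp a ha
    obtain ⟨b, hb⟩ := (hp (f a) (mem_image_of_mem f ha)).1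
    grind
  · grind
  · grind
  · intro t ht
    have hmaps : ∀ a ∈ t, f a ∈ s.image f := fun a ha =>
      mem_image_of_mem f (mem_powerset.1 (mem_filter.1 ht).1 ha)
    rw [prod_pow_eq_pow_sum, sum_attach _ fun i => #{a ∈ t | f a = i},
      ← card_eq_sum_card_fiberwise hmaps]

lemma sum_genBinom_mul_pow (q : R) {n : ℕ} (μ : n.Partition) :
    ∑ k ∈ range (n + 1), (genBinom μ k : R) * q ^ k =
      ∏ i ∈ Icc 1 n, ((1 + q) ^ i - 1) ^ mult μ i := by
  calc ∑ k ∈ range (n + 1), (genBinom μ k : R) * q ^ k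
    _ = ∑ S ∈ (diagram μ).cells.powerset with ∀ c ∈ (diagram μ).cells, ∃ s ∈ S, s.1 = c.1,
          q ^ #S := by
        rw [sum_filter, sum_powerset, card_cells_diagram]
        refine sum_congr rfl fun k _ => ?_
        rw [← sum_filter, genBinom, ← nsmul_eq_mul, ← sum_const]
        refine sum_congr rfl fun S hS => ?_
        rw [(mem_powersetCard.1 (mem_filter.1 hS).1).2]
    _ = ∏ i ∈ range ((diagram μ).colLen 0), ((1 + q) ^ (diagram μ).rowLen i - 1) := by
        rw [sum_pow_card_filter_meets_fibers, image_fst_cells]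
        exact prod_congr rfl fun i _ => by rw [YoungDiagram.rowLen_eq_card]; rfl
    _ = ∏ i ∈ Icc 1 n, ((1 + q) ^ i - 1) ^ mult μ i := by
        rw [← prod_map_rowLens _ fun m => (1 + q) ^ m - 1, prod_map_rowLens_diagram,
          prod_map_parts]

end Diagram

section CycleSum

variable {R : Type*} [CommRing R] [Algebra ℚ R]

/-- The term `p_μ / z_μ`, with `p_μ = ∏ i, p i ^ m_i(μ)`, of the cycle index sum. -/
noncomputable def cycleTerm (p : ℕ → R) {n : ℕ} (μ : n.Partition) : R :=
  (zee μ : ℚ)⁻¹ • ∏ i ∈ Icc 1 n, p i ^ mult μ i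

/-- The cycle index `∑_{|μ| = n} p_μ / z_μ` of the symmetric group of degree `n`; it is the
complete homogeneous symmetric function `h_n` when the `p i` are the power sums. -/
noncomputable def cycleSum (p : ℕ → R) (n : ℕ) : R := ∑ μ : n.Partition, cycleTerm p μ

lemma cycleSum_zero (p : ℕ → R) : cycleSum p 0 = 1 := by
  simp [cycleSum, cycleTerm, zee]

lemma cycleTerm_eq_prod_of_le (p : ℕ → R) {n m : ℕ} (μ : n.Partition) (hnm : n ≤ m) :
    cycleTerm p μ = ∏ i ∈ Icc 1 m,
      ((i ^ mult μ i * (mult μ i).factorial : ℕ) : ℚ)⁻¹ • p i ^ mult μ i := by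
  rw [cycleTerm, zee, Nat.cast_prod, ← prod_inv_distrib, ← prod_smul]
  refine prod_subset (Icc_subset_Icc_right hnm) fun i hi hi' => ?_
  rw [mult_eq_zero_of_lt μ (by simp only [mem_Icc] at hi hi'; omega)]
  simp

lemma mult_mul_cycleTerm_of_parts_eq_cons (p : ℕ → R) {n m i : ℕ} {μ : n.Partition}
    {ν : m.Partition} (h : μ.parts = i ::ₘ ν.parts) :
    ((mult μ i * i : ℕ) : R) * cycleTerm p μ = p i * cycleTerm p ν := by
  have hi_mem : i ∈ μ.parts := h ▸ Multiset.mem_cons_self i ν.parts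
  have hi : i ∈ Icc 1 n := mem_Icc.2 ⟨μ.parts_pos hi_mem, Nat.Partition.le_of_mem_parts hi_mem⟩
  have hmn : m ≤ n := by
    rw [← μ.parts_sum, h, Multiset.sum_cons, ν.parts_sum]
    exact Nat.le_add_left m i
  have mult_self : mult μ i = mult ν i + 1 := by
    rw [mult, h, Multiset.count_cons_self, mult]
  have mult_of_ne : ∀ a ∈ (Icc 1 n).erase i, mult μ a = mult ν a := fun a ha => by
    rw [mult, h, Multiset.count_cons_of_ne (ne_of_mem_erase ha), mult]
  rw [cycleTerm_eq_prod_of_le p μ le_rfl, cycleTerm_eq_prod_of_le p ν hmn,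
    ← mul_prod_erase _ _ hi, ← mul_prod_erase _ _ hi, ← mul_assoc, ← mul_assoc,
    prod_congr rfl fun a ha => by rw [mult_of_ne a ha], mult_self]
  congr 1
  have hi_ne : (i : ℚ) ≠ 0 := by exact_mod_cast (μ.parts_pos hi_mem).ne'
  rw [← nsmul_eq_mul, ← Nat.cast_smul_eq_nsmul ℚ, smul_smul, mul_smul_comm, ← pow_succ']
  congr 1
  rw [Nat.factorial_succ]
  push_cast
  field_simp
  ring

lemma sum_mult_mul_cycleTerm (p : ℕ → R) {n i : ℕ} (hi : 1 ≤ i) (hin : i ≤ n) :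
    ∑ μ : n.Partition, ((mult μ i * i : ℕ) : R) * cycleTerm p μ = p i * cycleSum p (n - i) := by
  have h_supp : ∀ μ ∈ (univ : Finset n.Partition),
      ((mult μ i * i : ℕ) : R) * cycleTerm p μ ≠ 0 → i ∈ μ.parts := by
    intro μ _
    contrapose!
    intro h
    rw [mult, Multiset.count_eq_zero_of_notMem h]
    simp
  rw [← sum_filter_of_ne h_supp, cycleSum, mul_sum,
    sum_subtype (p := fun μ : n.Partition => i ∈ μ.parts) _ (by simp)]
  refine Fintype.sum_equiv (Nat.Partition.partitionWithPartEquiv hi hin) _ _ fun μ =>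
    mult_mul_cycleTerm_of_parts_eq_cons p ?_
  rw [Nat.Partition.partitionWithPartEquiv_apply_parts, Multiset.cons_erase μ.2]

lemma natCast_mul_cycleSum (p : ℕ → R) (n : ℕ) :
    (n : R) * cycleSum p n = ∑ i ∈ Icc 1 n, p i * cycleSum p (n - i) := by
  calc (n : R) * cycleSum p n
    _ = ∑ μ : n.Partition, ∑ i ∈ Icc 1 n, ((mult μ i * i : ℕ) : R) * cycleTerm p μ := by
        rw [cycleSum, mul_sum]
        refine sum_congr rfl fun μ _ => ?_
        rw [← sum_mul, ← Nat.cast_sum, sum_mult_mul]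
    _ = ∑ i ∈ Icc 1 n, p i * cycleSum p (n - i) := by
        rw [sum_comm]
        exact sum_congr rfl fun i hi =>
          sum_mult_mul_cycleTerm p (mem_Icc.1 hi).1 (mem_Icc.1 hi).2

lemma cycleSum_pow_mul (a : R) (p : ℕ → R) (n : ℕ) :
    cycleSum (fun i => a ^ i * p i) n = a ^ n * cycleSum p n := by
  rw [cycleSum, cycleSum, mul_sum]
  refine sum_congr rfl fun μ _ => ?_
  have h_weight : ∏ i ∈ Icc 1 n, (a ^ i) ^ mult μ i = a ^ n := by
    simp only [← pow_mul', prod_pow_eq_pow_sum, sum_mult_mul]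
  simp only [cycleTerm, mul_pow, prod_mul_distrib, h_weight, mul_smul_comm]

lemma aeval_P (p : ℕ → R) (j k : ℕ) :
    MvPolynomial.aeval p (P j k) = ∑ μ : j.Partition, (genBinom μ k : R) * cycleTerm p μ := by
  simp only [P, map_sum, map_mul, map_prod, map_pow, MvPolynomial.aeval_X, MvPolynomial.aeval_C]
  refine sum_congr rfl fun μ _ => ?_
  rw [cycleTerm, div_eq_mul_inv, map_mul, map_natCast, mul_assoc, Algebra.smul_def]

lemma sum_aeval_P_mul_pow (p : ℕ → R) (q : R) (j : ℕ) :
    ∑ k ∈ range (j + 1), MvPolynomial.aeval p (P j k) * q ^ k =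
      cycleSum (fun i => ((1 + q) ^ i - 1) * p i) j := by
  simp only [aeval_P, sum_mul]
  rw [sum_comm, cycleSum]
  refine sum_congr rfl fun μ _ => ?_
  simp only [cycleTerm, mul_pow, prod_mul_distrib, ← sum_genBinom_mul_pow, sum_mul, smul_sum]
  refine sum_congr rfl fun k _ => ?_
  rw [mul_right_comm, mul_smul_comm]

end CycleSum

section ExponentialFormula

variable {R : Type*} [CommRing R]

lemma eq_of_derivative_eq_mul [IsAddTorsionFree R] {f g L : R⟦X⟧} (hf : d⁄dX R f = L * f)
    (hg : d⁄dX R g = L * g) (h : constantCoeff f = constantCoeff g) : f = g := by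
  ext n
  induction n using Nat.strong_induction_on with
  | _ n ih =>
    cases n with
    | zero => simpa using h
    | succ n =>
      have h_coeff : coeff n (d⁄dX R f) = coeff n (d⁄dX R g) := by
        rw [hf, hg, coeff_mul, coeff_mul]
        refine sum_congr rfl fun p hp => ?_
        rw [ih p.2 (Nat.antidiagonal.snd_lt hp)]
      rw [coeff_derivative, coeff_derivative, ← Nat.cast_succ, mul_comm, ← nsmul_eq_mul,
        mul_comm, ← nsmul_eq_mul] at h_coeff
      exact nsmul_right_injective n.succ_ne_zero h_coeff

lemma derivative_one_sub_C_mul_X (c : R) :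
    d⁄dX R (1 - C c * X) = -(mk fun i => c ^ (i + 1)) * (1 - C c * X) := by
  have h_geom : mk (fun i => c ^ i) * (1 - C c * X) = 1 := by
    simpa [rescale_mk] using congrArg (rescale c) (mk_one_mul_one_sub_eq_one R)
  have h_shift : mk (fun i => c ^ (i + 1)) = C c * mk fun i => c ^ i := by
    ext i
    simp [pow_succ']
  rw [h_shift, neg_mul, mul_assoc, h_geom]
  simp [Derivation.leibniz]

lemma derivative_prod_one_sub_C_mul_X {ι : Type*} (s : Finset ι) (c : ι → R) :
    d⁄dX R (∏ a ∈ s, (1 - C (c a) * X)) =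
      -(∑ a ∈ s, mk fun i => c a ^ (i + 1)) * ∏ a ∈ s, (1 - C (c a) * X) := by
  classical
  induction s using Finset.induction_on with
  | empty => simp
  | insert a s ha ih =>
    rw [prod_insert ha, sum_insert ha, Derivation.leibniz, ih, derivative_one_sub_C_mul_X]
    simp only [smul_eq_mul]
    ring

variable [Algebra ℚ R]

lemma derivative_mk_cycleSum (p : ℕ → R) :
    d⁄dX R (mk (cycleSum p)) = mk (fun i => p (i + 1)) * mk (cycleSum p) := by
  ext n
  rw [coeff_derivative, coeff_mk, coeff_mul, mul_comm, ← Nat.cast_succ, natCast_mul_cycleSum,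
    Nat.sum_antidiagonal_eq_sum_range_succ_mk, ← Ico_add_one_right_eq_Icc, range_eq_Ico,
    ← sum_Ico_add' _ 0 (n + 1) 1]
  simp

lemma mk_cycleSum_mul_prod {ι : Type*} (s : Finset ι) (b c : ι → R) {p : ℕ → R}
    (hp : ∀ i, p i = ∑ a ∈ s, (c a ^ i - b a ^ i)) :
    mk (cycleSum p) * ∏ a ∈ s, (1 - C (c a) * X) = ∏ a ∈ s, (1 - C (b a) * X) := by
  have : IsAddTorsionFree R := IsAddTorsionFree.of_module_rat R
  refine eq_of_derivative_eq_mul (L := -∑ a ∈ s, mk fun i => b a ^ (i + 1)) ?_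
    (derivative_prod_one_sub_C_mul_X s b) ?_
  · have h_sub : mk (fun i => p (i + 1)) =
        (∑ a ∈ s, mk fun i => c a ^ (i + 1)) - ∑ a ∈ s, mk fun i => b a ^ (i + 1) := by
      ext i
      simp [hp, sum_sub_distrib]
    rw [Derivation.leibniz, derivative_mk_cycleSum, derivative_prod_one_sub_C_mul_X, h_sub]
    simp only [smul_eq_mul]
    ring
  · simp [map_prod, cycleSum_zero]

lemma zpow_mul_sum_aeval_P_mul_pow {ι : Type*} (w : Rˣ) (s : Finset ι) (c : ι → R) (j : ℕ) :
    ((w ^ ((#s : ℤ) - j) : Rˣ) : R) * ∑ k ∈ range (j + 1),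
        MvPolynomial.aeval (fun i => ∑ a ∈ s, c a ^ i) (P j k) * ((w : R) - 1) ^ k =
      (w : R) ^ #s *
        cycleSum (fun i => ∑ a ∈ s, (c a ^ i - (((w⁻¹ : Rˣ) : R) * c a) ^ i)) j := by
  have h_rescale : ∀ i, ∑ a ∈ s, (c a ^ i - (((w⁻¹ : Rˣ) : R) * c a) ^ i) =
      ((w⁻¹ : Rˣ) : R) ^ i * (((1 + ((w : R) - 1)) ^ i - 1) * ∑ a ∈ s, c a ^ i) := by
    intro i
    rw [add_sub_cancel, ← mul_assoc, mul_sub, ← mul_pow, Units.inv_mul, mul_sum]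
    refine sum_congr rfl fun a _ => ?_
    rw [mul_pow]
    ring
  rw [sum_aeval_P_mul_pow, funext h_rescale, cycleSum_pow_mul, zpow_sub, ← inv_zpow]
  simp only [zpow_natCast, Units.val_mul, Units.val_pow_eq_pow_val, mul_assoc]

theorem mk_sum_aeval_P_mul_prod {ι : Type*} (w : Rˣ) (s : Finset ι) (c : ι → R) :
    mk (fun j : ℕ => ((w ^ ((#s : ℤ) - j) : Rˣ) : R) * ∑ k ∈ range (j + 1),
        MvPolynomial.aeval (fun i => ∑ a ∈ s, c a ^ i) (P j k) * ((w : R) - 1) ^ k) *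
      ∏ a ∈ s, (1 - C (c a) * X) = ∏ a ∈ s, (C (w : R) - C (c a) * X) := by
  have h_factor : ∀ a, C (w : R) - C (c a) * X =
      C (w : R) * (1 - C (((w⁻¹ : Rˣ) : R) * c a) * X) := by
    intro a
    rw [mul_sub, mul_one, ← mul_assoc, ← map_mul, Units.mul_inv_cancel_left]
  have h_scale : ∀ h : ℕ → R, mk (fun j => (w : R) ^ #s * h j) = C (w : R) ^ #s * mk h := by
    intro h
    ext j
    rw [coeff_mk, ← map_pow, coeff_C_mul, coeff_mk]
  simp only [zpow_mul_sum_aeval_P_mul_pow, h_factor]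
  rw [h_scale, mul_assoc, mk_cycleSum_mul_prod s _ c fun i => rfl, prod_mul_distrib, prod_const]

end ExponentialFormula

section ZPow

variable {R : Type*} [CommRing R]

lemma coeff_units_zpow {w : R⟦X⟧ˣ} {a : R} (hw : (w : R⟦X⟧) = 1 + C a * X) (m : ℤ) (i : ℕ) :
    coeff i ((w ^ m : R⟦X⟧ˣ) : R⟦X⟧) = (Ring.choose m i : ℤ) * a ^ i := by
  have h_nat : ∀ n : ℕ, ((w ^ n : R⟦X⟧ˣ) : R⟦X⟧) = rescale a (binomialSeries R (n : ℤ)) := by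
    intro n
    simp [binomialSeries_nat, hw, rescale_X]
  have h_int : ((w ^ m : R⟦X⟧ˣ) : R⟦X⟧) = rescale a (binomialSeries R m) := by
    obtain ⟨n, rfl | rfl⟩ := m.eq_nat_or_neg
    · rw [zpow_natCast, h_nat]
    · rw [zpow_neg, zpow_natCast]
      refine Units.inv_eq_of_mul_eq_one_left ?_
      rw [h_nat, ← map_mul, ← binomialSeries_add, neg_add_cancel, binomialSeries_zero, map_one]
  rw [h_int, coeff_rescale, binomialSeries_coeff, zsmul_one, mul_comm]

lemma coeff_units_zpow_mul_sum {w : R⟦X⟧ˣ} {a : R} (hw : (w : R⟦X⟧) = 1 + C a * X) (m : ℤ)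
    (f : ℕ → R) (i j : ℕ) :
    coeff i (((w ^ m : R⟦X⟧ˣ) : R⟦X⟧) * ∑ k ∈ range (j + 1), C (f k) * ((w : R⟦X⟧) - 1) ^ k) =
      a ^ i * ∑ k ∈ range (min i j + 1), (Ring.choose m (i - k) : ℤ) * f k := by
  have h_term : ∀ k, coeff i (((w ^ m : R⟦X⟧ˣ) : R⟦X⟧) * (C (f k) * ((w : R⟦X⟧) - 1) ^ k)) =
      if k ≤ i then a ^ i * ((Ring.choose m (i - k) : ℤ) * f k) else 0 := by
    intro k
    rw [hw, add_sub_cancel_left, mul_pow, mul_left_comm, coeff_C_mul, ← map_pow, mul_left_comm,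
      coeff_C_mul, coeff_mul_X_pow', mul_ite, mul_zero, mul_ite, mul_zero]
    refine if_ctx_congr Iff.rfl (fun hk => ?_) fun _ => rfl
    rw [coeff_units_zpow hw, ← pow_mul_pow_sub a hk]
    ring
  rw [mul_sum, map_sum, mul_sum, sum_congr rfl fun k _ => h_term k, ← sum_filter]
  refine sum_congr ?_ fun _ _ => rfl
  ext k
  simp only [mem_filter, mem_range]
  omega

end ZPow

section OuterEvaluation

variable {R : Type*} [CommRing R]

open scoped PowerSeries.WithPiTopology

lemma hasEval_C_mul_X [TopologicalSpace R] (b : R) : HasEval (C b * X : R⟦X⟧) :=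
  WithPiTopology.isTopologicallyNilpotent_of_constantCoeff_zero (by simp)

/-- The evaluation of the outer indeterminate of a double power series at `b X`, where `X` is the
inner indeterminate; the coefficients carry the discrete topology. -/
noncomputable def evalOuter (b : R) : R⟦X⟧⟦X⟧ →+* R⟦X⟧ :=
  letI : UniformSpace R := ⊥
  haveI : DiscreteUniformity R := ⟨rfl⟩
  eval₂Hom (φ := RingHom.id R⟦X⟧) continuous_id (hasEval_C_mul_X b)

lemma evalOuter_C (b : R) (f : R⟦X⟧) : evalOuter b (C f) = f := by
  let : UniformSpace R := ⊥
  have : DiscreteUniformity R := ⟨rfl⟩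
  rw [evalOuter, coe_eval₂Hom, eval₂_C, RingHom.id_apply]

lemma evalOuter_X (b : R) : evalOuter b X = C b * X := by
  let : UniformSpace R := ⊥
  have : DiscreteUniformity R := ⟨rfl⟩
  rw [evalOuter, coe_eval₂Hom, eval₂_X]

lemma coeff_evalOuter (b : R) (G : R⟦X⟧⟦X⟧) (n : ℕ) :
    coeff n (evalOuter b G) = ∑ p ∈ antidiagonal n, b ^ p.2 * coeff p.1 (coeff p.2 G) := by
  let : UniformSpace R := ⊥
  have : DiscreteUniformity R := ⟨rfl⟩
  have h_term : ∀ j, coeff n (coeff j G * (C b * X) ^ j) =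
      if j ≤ n then b ^ j * coeff (n - j) (coeff j G) else 0 := by
    intro j
    rw [mul_pow, mul_left_comm, ← map_pow, coeff_C_mul, coeff_mul_X_pow', mul_ite, mul_zero]
  have h_sum : HasSum (fun j => coeff n (coeff j G * (C b * X) ^ j)) (coeff n (evalOuter b G)) := by
    rw [evalOuter, coe_eval₂Hom]
    exact (hasSum_eval₂ (φ := RingHom.id R⟦X⟧) continuous_id (hasEval_C_mul_X b) G).map
      (coeff n) (WithPiTopology.continuous_coeff R n)
  have h_fin : ∑ p ∈ antidiagonal n, b ^ p.2 * coeff p.1 (coeff p.2 G) =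
      ∑ j ∈ range (n + 1), coeff n (coeff j G * (C b * X) ^ j) := by
    rw [← Nat.sum_antidiagonal_swap, Nat.sum_antidiagonal_eq_sum_range_succ_mk]
    refine sum_congr rfl fun j hj => ?_
    rw [h_term, if_pos (Nat.lt_succ_iff.1 (mem_range.1 hj))]
    rfl
  rw [h_fin]
  refine h_sum.unique (hasSum_sum_of_ne_finset_zero fun j hj => ?_)
  rw [h_term, if_neg (by simpa [Nat.lt_succ_iff] using hj)]

end OuterEvaluation

section Expansion

variable {R ι : Type*} [CommRing R] [Algebra ℚ R]

lemma map_aeval_sum_pow {S : Type*} [CommRing S] [Algebra ℚ S] (f : R →+* S) (s : Finset ι)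
    (c : ι → R) (p : MvPolynomial ℕ ℚ) :
    f (MvPolynomial.aeval (fun i => ∑ a ∈ s, c a ^ i) p) =
      MvPolynomial.aeval (fun i => ∑ a ∈ s, f (c a) ^ i) p := by
  simpa using MvPolynomial.comp_aeval_apply (fun i => ∑ a ∈ s, c a ^ i) f.toRatAlgHom p

/-- The inner sum of the expansion: its entry of index `(i, j)`, for the family of contents
`c a`, where `a` runs through `s`. -/
noncomputable def expansionCoeff (s : Finset ι) (c : ι → R) (i j : ℕ) : R :=
  ∑ k ∈ range (min i j + 1), ((Ring.choose ((#s : ℤ) - (j : ℤ)) (i - k) : ℤ) : R) *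
    MvPolynomial.aeval (fun m => ∑ a ∈ s, c a ^ m) (P j k)

lemma map_expansionCoeff {S : Type*} [CommRing S] [Algebra ℚ S] (f : R →+* S) (s : Finset ι)
    (c : ι → R) (i j : ℕ) :
    f (expansionCoeff s c i j) = expansionCoeff s (fun a => f (c a)) i j := by
  simp only [expansionCoeff, map_sum, map_mul, map_intCast, map_aeval_sum_pow]

lemma expansionCoeff_content (α : ℝ) {n : ℕ} (μ : n.Partition) (i j : ℕ) :
    expansionCoeff (diagram μ).cells (content α) i j =
      ∑ k ∈ range (min i j + 1),
        ((Ring.choose ((n : ℤ) - (j : ℤ)) (i - k) : ℤ) : ℝ) * F α j k μ := by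
  rw [expansionCoeff, card_cells_diagram]
  rfl

theorem mk_expansionCoeff_mul_prod (x : R) (s : Finset ι) (c : ι → R) :
    mk (fun n => ∑ p ∈ antidiagonal n, (-1) ^ (p.1 + p.2) * x ^ p.1 *
        expansionCoeff s c p.1 p.2) * ∏ a ∈ s, (1 + C (c a) * X) =
      ∏ a ∈ s, (1 + C (c a - x) * X) := by
  obtain ⟨w, hw⟩ : IsUnit (1 + C (-x) * X : R⟦X⟧) := by
    simp [isUnit_iff_constantCoeff]
  have h_formal := congrArg (evalOuter (-1)) (mk_sum_aeval_P_mul_prod w s fun a => C (c a))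
  simp only [← map_aeval_sum_pow, map_mul, map_prod, map_sub, map_one, evalOuter_C,
    evalOuter_X, hw] at h_formal
  convert h_formal using 2
  · ext n
    rw [coeff_mk, coeff_evalOuter]
    refine sum_congr rfl fun p _ => ?_
    rw [coeff_mk, ← hw, coeff_units_zpow_mul_sum hw, expansionCoeff]
    ring
  · simp
  · simp only [map_sub, map_neg, map_one]
    ring

end Expansion

section Laurent

variable {K : Type*} [Field K]

open WithZero in
lemma exists_nat_forall_coeff_eq_zero_mem {U : Set (LaurentSeries K)} (hU : U ∈ nhds 0) :
    ∃ n : ℕ, ∀ f : LaurentSeries K, (∀ m < (n : ℤ), f.coeff m = 0) → f ∈ U := by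
  obtain ⟨γ, hγ⟩ := Valued.mem_nhds_zero.1 hU
  obtain ⟨n, hn⟩ : ∃ n : ℕ, exp (-(n : ℤ)) < MonoidWithZeroHom.ValueGroup₀.embedding γ.1 := by
    have hne : MonoidWithZeroHom.ValueGroup₀.embedding γ.1 ≠ 0 := by simp
    refine ⟨(1 - log (MonoidWithZeroHom.ValueGroup₀.embedding γ.1)).toNat, ?_⟩
    rw [← lt_log_iff_exp_lt hne]
    omega
  refine ⟨n, fun f hf => hγ ?_⟩
  rw [Set.mem_ofPred_eq, Valuation.restrict_lt_iff_lt_embedding]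
  exact ((LaurentSeries.valuation_le_iff_coeff_lt_eq_zero K).2 hf).trans_lt hn

lemma hasSum_of_forall_exists_coeff_eq {β : Type*} {f : β → LaurentSeries K} {g : LaurentSeries K}
    (h : ∀ n : ℕ, ∃ s : Finset β, ∀ t, s ⊆ t →
      ∀ m < (n : ℤ), (∑ b ∈ t, f b).coeff m = g.coeff m) :
    HasSum f g := by
  rw [HasSum, SummationFilter.unconditional_filter, ← tendsto_sub_nhds_zero_iff]
  intro U hU
  obtain ⟨n, hn⟩ := exists_nat_forall_coeff_eq_zero_mem hU
  obtain ⟨s, hs⟩ := h n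
  rw [Filter.mem_map]
  filter_upwards [Filter.mem_atTop s] with t ht
  refine hn _ fun m hm => ?_
  rw [HahnSeries.coeff_sub, hs t ht m hm, sub_self]

lemma hasSum_single_ofPowerSeries (a : ℕ × ℕ → K) :
    HasSum (fun p : ℕ × ℕ => (HahnSeries.single ((p.1 + p.2 : ℕ) : ℤ) (a p) : LaurentSeries K))
      (HahnSeries.ofPowerSeries ℤ K (mk fun n => ∑ p ∈ antidiagonal n, a p)) := by
  refine hasSum_of_forall_exists_coeff_eq fun n => ⟨range n ×ˢ range n, fun t ht m hm => ?_⟩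
  rw [HahnSeries.coeff_sum, PowerSeries.coeff_coe]
  simp only [HahnSeries.coeff_single]
  split_ifs with h_neg
  · exact sum_eq_zero fun p _ => if_neg (by omega)
  · lift m to ℕ using not_lt.1 h_neg
    simp only [Nat.cast_inj]
    rw [coeff_mk, ← sum_filter, Int.natAbs_natCast]
    refine sum_congr ?_ fun _ _ => rfl
    ext p
    rw [mem_filter, HasAntidiagonal.mem_antidiagonal]
    refine ⟨fun h => by omega, fun h => ⟨ht ?_, by omega⟩⟩
    simp only [mem_product, mem_range]
    omega

lemma neg_one_pow_mul_div_single_pow_mul_C (x r : K) (i m : ℕ) :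
    (-1 : LaurentSeries K) ^ m * (HahnSeries.C x ^ i / HahnSeries.single (-1 : ℤ) 1 ^ m) *
      HahnSeries.C r = HahnSeries.single (m : ℤ) ((-1) ^ m * x ^ i * r) := by
  have h_inv : ((HahnSeries.single (-1 : ℤ) (1 : K)) ^ m)⁻¹ = HahnSeries.single (m : ℤ) 1 := by
    rw [HahnSeries.single_pow, HahnSeries.inv_single]
    simp
  rw [div_eq_mul_inv, h_inv]
  have h_C : HahnSeries.single (m : ℤ) ((-1) ^ m * x ^ i * r) =
      HahnSeries.C ((-1) ^ m * x ^ i * r) * HahnSeries.single (m : ℤ) 1 := by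
    rw [HahnSeries.C_apply, HahnSeries.single_mul_single, zero_add, mul_one]
  rw [h_C]
  simp only [map_mul, map_pow, map_neg, map_one]
  ring

lemma single_neg_one_mul_one_add_C_mul_X (r : K) :
    HahnSeries.single (-1 : ℤ) 1 * HahnSeries.ofPowerSeries ℤ K (1 + C r * X) =
      HahnSeries.single (-1 : ℤ) 1 + HahnSeries.C r := by
  have h_inv : HahnSeries.single (-1 : ℤ) (1 : K) * HahnSeries.single 1 1 = 1 := by
    simp
  rw [map_add, map_one (HahnSeries.ofPowerSeries ℤ K), map_mul, HahnSeries.ofPowerSeries_C,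
    HahnSeries.ofPowerSeries_X, mul_add, mul_one, mul_left_comm, h_inv, mul_one]

lemma single_neg_one_add_C_ne_zero (r : K) :
    (HahnSeries.single (-1 : ℤ) 1 + HahnSeries.C r : LaurentSeries K) ≠ 0 := by
  intro h
  have h_coeff := congrArg (fun f : LaurentSeries K => f.coeff (-1)) h
  simp [HahnSeries.C_apply] at h_coeff

lemma prod_div_prod_eq_ofPowerSeries {ι : Type*} (s : Finset ι) (b c : ι → K) {f : K⟦X⟧}
    (hf : f * ∏ a ∈ s, (1 + C (c a) * X) = ∏ a ∈ s, (1 + C (b a) * X)) :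
    (∏ a ∈ s, (HahnSeries.single (-1 : ℤ) 1 + HahnSeries.C (b a))) /
      ∏ a ∈ s, (HahnSeries.single (-1 : ℤ) 1 + HahnSeries.C (c a)) =
        HahnSeries.ofPowerSeries ℤ K f := by
  rw [div_eq_iff (prod_ne_zero_iff.2 fun a _ => single_neg_one_add_C_ne_zero (c a))]
  simp only [← single_neg_one_mul_one_add_C_mul_X, prod_mul_distrib, ← map_prod, ← hf, map_mul]
  ring

end Laurent

end JackExpansion

theorem mainTheorem3_general {K ι : Type*} [Field K] [CharZero K] (x : K) (s : Finset ι)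
    (c : ι → K) :
    HasSum
      (fun p : ℕ × ℕ => (-1 : LaurentSeries K) ^ (p.1 + p.2) *
        (HahnSeries.C x ^ p.1 / HahnSeries.single (-1 : ℤ) 1 ^ (p.1 + p.2)) *
          HahnSeries.C (JackExpansion.expansionCoeff s c p.1 p.2))
      ((∏ a ∈ s, (HahnSeries.single (-1 : ℤ) 1 - HahnSeries.C x + HahnSeries.C (c a))) /
        ∏ a ∈ s, (HahnSeries.single (-1 : ℤ) 1 + HahnSeries.C (c a))) := by
  convert JackExpansion.hasSum_single_ofPowerSeries fun p : ℕ × ℕ =>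
    (-1) ^ (p.1 + p.2) * x ^ p.1 * JackExpansion.expansionCoeff s c p.1 p.2 using 2 with p
  · exact JackExpansion.neg_one_pow_mul_div_single_pow_mul_C x _ p.1 (p.1 + p.2)
  · rw [← JackExpansion.prod_div_prod_eq_ofPowerSeries s (fun a => c a - x) c
      (JackExpansion.mk_expansionCoeff_mul_prod x s c)]
    simp only [map_sub, sub_add_eq_add_sub, add_sub_assoc]

theorem mainTheorem3 (α : ℝ) (hα : 0 < α) (n : ℕ) (lam : n.Partition) :
    HasSum
      (fun p : ℕ × ℕ =>
        (-1 : JackExpansion.FormalField) ^ (p.1 + p.2) *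
          (JackExpansion.x ^ p.1 / JackExpansion.y ^ (p.1 + p.2)) *
          JackExpansion.const
            (∑ k ∈ Finset.range (min p.1 p.2 + 1),
              ((Ring.choose ((n : ℤ) - (p.2 : ℤ)) (p.1 - k) : ℤ) : ℝ) *
                JackExpansion.F α p.2 k lam))
      (JackExpansion.risingFactorial α lam (JackExpansion.y - JackExpansion.x) /
        JackExpansion.risingFactorial α lam JackExpansion.y) := by
  simp only [← JackExpansion.expansionCoeff_content, JackExpansion.const, RingHom.comp_apply,
    JackExpansion.map_expansionCoeff RatFunc.C]
  exact mainTheorem3_general RatFunc.X (JackExpansion.diagram lam).cells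
    fun c => RatFunc.C (JackExpansion.content α c)
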